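/- For a positive integer $n$ let $OE(n)$ denote the number of odd-even partitions of $n$, that is, partitions of $n$ whose parts, listed from the smallest to the largest, alternate in parity, the smallest part being odd. Let $$\mathscr O(q)=1+\sum_{n=1}^{\infty}OE(n)\,q^n$$ be their generating function. Then the series $\mathscr O(e^{-\varepsilon})$ converges for every real $\varepsilon>0$, and $$\mathscr O(e^{-\varepsilon})\sim\sqrt{\frac{2}{\sqrt5}}\;e^{\frac{\pi^2}{20\varepsilon}}\qquad\text{as }\varepsilon\to0^+,$$ i.e. the quotient of the two sides tends to $1$ as $\varepsilon$ tends to $0$ through positive real numbers. -/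

import Mathlib

open Filter Topology Asymptotics

/-- A partition is odd-even if its parts, listed in nondecreasing order, alternate in parity,
starting with an odd smallest part. (The empty partition of `0` satisfies this vacuously.) -/
def IsOddEvenPartition {n : ℕ} (p : n.Partition) : Prop :=
  (∀ a ∈ (p.parts.sort (· ≤ ·)).head?, Odd a) ∧
    (p.parts.sort (· ≤ ·)).IsChain (fun a b => ¬ (Even a ↔ Even b))

instance {n : ℕ} (p : n.Partition) : Decidable (IsOddEvenPartition p) :=
  inferInstanceAs (Decidable (_ ∧ _))

/-- `OE n` is the number of odd-even partitions of `n`. -/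
def OE (n : ℕ) : ℕ :=
  (Finset.univ.filter fun p : n.Partition => IsOddEvenPartition p).card

/-- The generating function `1 + ∑_{n ≥ 1} OE(n) q ^ n` of odd-even partitions. -/
noncomputable def oddEvenGenFun (q : ℝ) : ℝ :=
  1 + ∑' n : ℕ, (OE (n + 1) : ℝ) * q ^ (n + 1)

/-! Coding a partition by the gaps between its parts turns odd-even partitions with `k` parts into
`k`-tuples of naturals, whence $\mathscr O(q)=\sum_k\prod_{j\le k}q^j/(1-q^{2j})$
(`tsum_OE_eq_tsum_prod`).

For $q=e^{-\varepsilon}$ the logarithm of the `k`-th term is $\sum_{j\le k}$ `oddEvenSlope`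
$(j\varepsilon)$. Euler–Maclaurin, with Stirling absorbing the logarithmic singularity at $0$, makes
the term $\sqrt\varepsilon\,e^{\Phi(k\varepsilon)/\varepsilon}$ up to an explicit constant, $\Phi$
being `oddEvenPhase` (`tendsto_logOddEvenTerm_sub`). The slope vanishes where $e^{-t}=1-e^{-2t}$,
that is at $t=\log\varphi$. There $\Phi=\pi^2/20$, by the value of the dilogarithm at $\varphi^{-2}$
(`dilog_inv_goldenRatio_sq`), and $\Phi''=-\sqrt5$.

So the terms form a Gaussian profile of width $\varepsilon^{-1/2}$ in `k`. The sum is the integral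
of a step function; rescaled by that width, it converges by dominated convergence, with
`logOddEvenTerm_le` giving the bound, to $\int\pi^{-1/2}e^{-\sqrt5y^2/2}\,dy=\sqrt{2/\sqrt5}$. -/

/-! ### Coding odd-even partitions by gaps -/

/-- The list of partial sums `c + ∑ (2 dᵢ + 1)`. -/
def oddGapSums (c : ℕ) : List ℕ → List ℕ
  | [] => []
  | d :: ds => (c + 2 * d + 1) :: oddGapSums (c + 2 * d + 1) ds

/-- Strict increase together with change of parity. -/
def OddGap (a b : ℕ) : Prop := a < b ∧ ¬ (Even a ↔ Even b)

theorem oddGap_add (c d : ℕ) : OddGap c (c + 2 * d + 1) := by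
  refine ⟨by omega, ?_⟩
  simp only [Nat.even_iff]; omega

theorem isChain_oddGapSums (ds : List ℕ) (c : ℕ) : List.IsChain OddGap (c :: oddGapSums c ds) := by
  induction ds generalizing c with
  | nil => simp [oddGapSums]
  | cons d ds ih =>
    rw [oddGapSums, List.isChain_cons_cons]
    exact ⟨oddGap_add c d, ih _⟩

theorem exists_oddGapSums_eq (l : List ℕ) (c : ℕ) (h : List.IsChain OddGap (c :: l)) :
    ∃ ds, oddGapSums c ds = l := by
  induction l generalizing c with
  | nil => exact ⟨[], rfl⟩
  | cons a l ih =>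
    rw [List.isChain_cons_cons] at h
    obtain ⟨⟨hlt, hpar⟩, hl⟩ := h
    obtain ⟨ds, hds⟩ := ih a hl
    -- The difference `a - c` is odd, so halving it rounds down to the gap parameter.
    have ha : c + 2 * ((a - c) / 2) + 1 = a := by
      simp only [Nat.even_iff] at hpar; omega
    exact ⟨((a - c) / 2) :: ds, by rw [oddGapSums, ha, hds]⟩

theorem oddGapSums_injective (c : ℕ) : Function.Injective (oddGapSums c) := by
  intro l
  induction l generalizing c with
  | nil => intro m h; cases m <;> simp_all [oddGapSums]
  | cons a l ih =>
    intro m h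
    cases m with
    | nil => simp [oddGapSums] at h
    | cons b m =>
      simp only [oddGapSums, List.cons.injEq] at h
      obtain ⟨h1, h2⟩ := h
      obtain rfl : a = b := by omega
      rw [ih _ h2]

theorem sum_oddGapSums (ds : List ℕ) (c : ℕ) :
    (oddGapSums c ds).sum = c * ds.length + (oddGapSums 0 ds).sum := by
  induction ds generalizing c with
  | nil => simp [oddGapSums]
  | cons d ds ih =>
    simp only [oddGapSums, List.sum_cons, List.length_cons]
    rw [ih, ih (0 + 2 * d + 1)]; ring

/-- The first gap is a summand of every part, so its contribution separates from the others. This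
makes the generating function factor. -/
theorem sum_oddGapSums_cons (d : ℕ) (ds : List ℕ) :
    (oddGapSums 0 (d :: ds)).sum = (2 * d + 1) * (ds.length + 1) + (oddGapSums 0 ds).sum := by
  simp only [oddGapSums, List.sum_cons]
  rw [sum_oddGapSums]; ring

theorem sortedLE_oddGapSums (ds : List ℕ) : (oddGapSums 0 ds).Pairwise (· ≤ ·) := by
  have h := (isChain_oddGapSums ds 0).imp (S := fun a b => a ≤ b) (fun a b h => h.1.le)
  exact (List.pairwise_cons.1 (List.isChain_iff_pairwise.1 h)).2

theorem pos_of_mem_oddGapSums {ds : List ℕ} {a : ℕ} (ha : a ∈ oddGapSums 0 ds) : 0 < a := by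
  have h := (isChain_oddGapSums ds 0).imp (S := fun a b => a < b) (fun a b h => h.1)
  exact (List.pairwise_cons.1 (List.isChain_iff_pairwise.1 h)).1 a ha

/-- A prepended `0` encodes the oddness of the smallest part as a change of parity. Strictness is
automatic, since equal neighbours have equal parity. -/
theorem isOddEvenPartition_iff {n : ℕ} (p : n.Partition) :
    IsOddEvenPartition p ↔ List.IsChain OddGap (0 :: p.parts.sort (· ≤ ·)) := by
  rw [IsOddEvenPartition, List.isChain_cons]
  have hs : List.IsChain (· ≤ ·) (p.parts.sort (· ≤ ·)) :=
    (Multiset.pairwise_sort p.parts (· ≤ ·)).isChain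
  refine and_congr (forall₂_congr fun a _ => ?_) ⟨fun h => ?_, fun h => h.imp fun a b h => h.2⟩
  · rw [OddGap, ← Nat.not_even_iff_odd]
    simp only [Even.zero, true_iff, iff_and_self]
    exact fun h => Nat.pos_of_ne_zero fun h0 => h (h0 ▸ Even.zero)
  · rw [List.isChain_iff_getElem] at hs h ⊢
    intro i hi
    have h1 := hs i hi
    have h2 := h i hi
    exact ⟨lt_of_le_of_ne h1 fun he => h2 (by rw [he]), h2⟩

/-- Odd-even partitions of `n` correspond to lists of naturals via their gaps. -/
theorem exists_gaps_equiv (n : ℕ) :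
    Nonempty ({p : n.Partition // IsOddEvenPartition p} ≃
      {ds : List ℕ // (oddGapSums 0 ds).sum = n}) := by
  have key : ∀ p : {p : n.Partition // IsOddEvenPartition p},
      ∃ ds, oddGapSums 0 ds = p.1.parts.sort (· ≤ ·) := fun p =>
    exists_oddGapSums_eq _ _ ((isOddEvenPartition_iff p.1).1 p.2)
  choose f hf using key
  have hsum : ∀ p, (oddGapSums 0 (f p)).sum = n := fun p => by
    rw [hf, ← Multiset.sum_coe, Multiset.sort_eq, p.1.parts_sum]
  refine ⟨Equiv.ofBijective (fun p => ⟨f p, hsum p⟩) ⟨fun p r h => ?_, ?_⟩⟩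
  · have h' : f p = f r := congrArg Subtype.val h
    have h2 := hf p
    rw [h', hf r] at h2
    have h3 := congrArg (fun l : List ℕ => (l : Multiset ℕ)) h2
    simp only [Multiset.sort_eq] at h3
    exact Subtype.ext (Nat.Partition.ext h3.symm)
  · rintro ⟨ds, hds⟩
    have hsort : (↑(oddGapSums 0 ds) : Multiset ℕ).sort (· ≤ ·) = oddGapSums 0 ds := by
      apply List.Perm.eq_of_pairwise (le := (· ≤ ·)) (fun a b _ _ => le_antisymm)
        (Multiset.pairwise_sort _ _) (sortedLE_oddGapSums ds)
      rw [← Multiset.coe_eq_coe, Multiset.sort_eq]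
    let p : n.Partition :=
      ⟨↑(oddGapSums 0 ds), fun {i} hi => pos_of_mem_oddGapSums (by simpa using hi), by simpa using hds⟩
    have hp : IsOddEvenPartition p := by
      rw [isOddEvenPartition_iff]
      change List.IsChain OddGap (0 :: (↑(oddGapSums 0 ds) : Multiset ℕ).sort (· ≤ ·))
      rw [hsort]; exact isChain_oddGapSums ds 0
    refine ⟨⟨p, hp⟩, Subtype.ext (oddGapSums_injective 0 ?_)⟩
    rw [hf]; exact hsort

/-! ### The generating function as a q-series -/

open scoped ENNReal

/-- Working in `ℝ≥0∞` allows regrouping by the sum, and later by the length, without any summability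
condition. -/
theorem tsum_OE_mul_pow (x : ℝ≥0∞) :
    ∑' n : ℕ, (OE n : ℝ≥0∞) * x ^ n = ∑' ds : List ℕ, x ^ (oddGapSums 0 ds).sum := by
  rw [← (Equiv.sigmaFiberEquiv fun ds : List ℕ => (oddGapSums 0 ds).sum).tsum_eq, ENNReal.tsum_sigma']
  refine tsum_congr fun n => ?_
  obtain ⟨e⟩ := exists_gaps_equiv n
  rw [← e.tsum_eq]
  have : ∀ p, x ^ (oddGapSums 0 ((Equiv.sigmaFiberEquiv fun ds : List ℕ =>
      (oddGapSums 0 ds).sum) ⟨n, e p⟩)).sum = x ^ n := fun p =>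
    congrArg (x ^ ·) (e p).2
  simp_rw [this]
  rw [tsum_fintype, Finset.sum_const, nsmul_eq_mul, Finset.card_univ, Fintype.card_subtype, OE]

/-- The gap counted in `j + 1` parts runs independently of the others and gives the geometric series
of $x^{(j+1)(2d+1)}$ over $d$. -/
theorem tsum_gaps_length (x : ℝ≥0∞) (k : ℕ) :
    ∑' v : Fin k → ℕ, x ^ (oddGapSums 0 (List.ofFn v)).sum =
      ∏ j ∈ Finset.range k, x ^ (j + 1) * (1 - x ^ (2 * (j + 1)))⁻¹ := by
  induction k with
  | zero => simp [oddGapSums]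
  | succ k ih =>
    rw [← (Fin.consEquiv fun _ : Fin (k + 1) => ℕ).tsum_eq, ENNReal.tsum_prod', Finset.prod_range_succ,
      ← ih, ← ENNReal.tsum_geometric, ← ENNReal.tsum_mul_left, mul_comm, ← ENNReal.tsum_mul_right]
    refine tsum_congr fun d => ?_
    rw [← ENNReal.tsum_mul_left]
    refine tsum_congr fun v => ?_
    change x ^ (oddGapSums 0 (List.ofFn (Fin.cons d v : Fin (k + 1) → ℕ))).sum = _
    rw [List.ofFn_cons, sum_oddGapSums_cons, List.length_ofFn]
    rw [← pow_mul, ← pow_add, ← pow_add]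
    ring_nf

theorem tsum_OE_eq_tsum_prod (x : ℝ≥0∞) :
    ∑' n : ℕ, (OE n : ℝ≥0∞) * x ^ n =
      ∑' k : ℕ, ∏ j ∈ Finset.range k, x ^ (j + 1) * (1 - x ^ (2 * (j + 1)))⁻¹ := by
  rw [tsum_OE_mul_pow, ← List.equivSigmaTuple.symm.tsum_eq, ENNReal.tsum_sigma']
  exact tsum_congr fun k => tsum_gaps_length x k

/-- The contribution to the generating function of the odd-even partitions with `k` parts. -/
noncomputable def oddEvenTerm (q : ℝ) (k : ℕ) : ℝ :=
  ∏ j ∈ Finset.range k, q ^ (j + 1) / (1 - q ^ (2 * (j + 1)))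

theorem hasSum_OE {q : ℝ} (h0 : 0 < q) (h1 : q < 1) (hs : Summable (oddEvenTerm q)) :
    HasSum (fun n => (OE n : ℝ) * q ^ n) (∑' k, oddEvenTerm q k) := by
  have hq : ∀ j : ℕ, 0 < 1 - q ^ (2 * (j + 1)) := fun j =>
    sub_pos.2 (pow_lt_one₀ h0.le h1 (by omega))
  have hpos : ∀ k, 0 ≤ oddEvenTerm q k := fun k =>
    Finset.prod_nonneg fun j _ => div_nonneg (by positivity) (hq j).le
  have hx : ∑' n : ℕ, ENNReal.ofReal ((OE n : ℝ) * q ^ n) =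
      ENNReal.ofReal (∑' k, oddEvenTerm q k) := by
    rw [ENNReal.ofReal_tsum_of_nonneg hpos hs]
    convert tsum_OE_eq_tsum_prod (ENNReal.ofReal q) using 3 with n k
    · rw [ENNReal.ofReal_mul (by positivity), ENNReal.ofReal_natCast, ENNReal.ofReal_pow h0.le]
    · rw [oddEvenTerm, ENNReal.ofReal_prod_of_nonneg
        fun j _ => div_nonneg (by positivity) (hq j).le]
      refine Finset.prod_congr rfl fun j _ => ?_
      rw [ENNReal.ofReal_div_of_pos (hq j), ENNReal.ofReal_pow h0.le, div_eq_mul_inv,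
        ENNReal.ofReal_sub _ (by positivity), ENNReal.ofReal_one, ENNReal.ofReal_pow h0.le]
  have hnn : ∀ n, 0 ≤ (OE n : ℝ) * q ^ n := fun n => by positivity
  have hsum : Summable fun n => (OE n : ℝ) * q ^ n := by
    have := ENNReal.summable_toReal (f := fun n => ENNReal.ofReal ((OE n : ℝ) * q ^ n))
      (by rw [hx]; exact ENNReal.ofReal_ne_top)
    simpa only [ENNReal.toReal_ofReal (hnn _)] using this
  rw [← ENNReal.ofReal_tsum_of_nonneg hnn hsum,
    ENNReal.ofReal_eq_ofReal_iff (tsum_nonneg hnn) (tsum_nonneg hpos)] at hx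
  rw [← hx]; exact hsum.hasSum

theorem OE_zero : OE 0 = 1 := by
  have : ∀ p : Nat.Partition 0, IsOddEvenPartition p := fun p => by
    rw [Subsingleton.elim p (Nat.Partition.indiscrete 0), IsOddEvenPartition]; simp
  simp [OE, this]

/-! ### The dilogarithm and its value at the inverse square of the golden ratio -/

/-- The dilogarithm `∑ xⁿ / n²`. -/
noncomputable def dilog (x : ℝ) : ℝ := ∑' n : ℕ, x ^ (n + 1) / ((n : ℝ) + 1) ^ 2

theorem summable_inv_succ_sq : Summable fun n : ℕ => 1 / ((n : ℝ) + 1) ^ 2 := by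
  have := (summable_nat_add_iff (f := fun n : ℕ => 1 / (n : ℝ) ^ 2) 1).2 hasSum_zeta_two.summable
  simpa using this

theorem dilog_zero : dilog 0 = 0 := by simp [dilog]

theorem dilog_one : dilog 1 = Real.pi ^ 2 / 6 := by
  have h := hasSum_zeta_two.tsum_eq
  rw [hasSum_zeta_two.summable.tsum_eq_zero_add] at h
  simpa [dilog] using h

theorem continuousOn_dilog : ContinuousOn dilog (Set.Icc 0 1) := by
  refine continuousOn_tsum (fun n => by fun_prop) summable_inv_succ_sq fun n x hx => ?_
  rw [Real.norm_of_nonneg (by have := hx.1; positivity)]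
  gcongr
  exact pow_le_one₀ hx.1 hx.2

/-- Termwise differentiation is legitimate on `(-r, r)` with `x < r < 1`, where the derivatives are
dominated by the geometric series in `r`; they sum to the logarithmic series divided by `x`. -/
theorem hasDerivAt_dilog {x : ℝ} (h0 : 0 < x) (h1 : x < 1) :
    HasDerivAt dilog (-Real.log (1 - x) / x) x := by
  obtain ⟨r, hxr, hr1⟩ := exists_between h1
  have hr0 : 0 < r := h0.trans hxr
  have hs := Real.hasSum_pow_div_log_of_abs_lt_one (x := x) (by rwa [abs_of_pos h0])
  have hs' := (hs.div_const x).tsum_eq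
  rw [← hs']
  have hd : ∀ (n : ℕ) (y : ℝ), y ∈ Set.Ioo (-r) r →
      HasDerivAt (fun z : ℝ => z ^ (n + 1) / ((n : ℝ) + 1) ^ 2) (y ^ n / ((n : ℝ) + 1)) y := by
    intro n y _
    convert! (hasDerivAt_pow (n + 1) y).div_const (((n : ℝ) + 1) ^ 2) using 1
    push_cast
    field_simp
  have := hasDerivAt_tsum_of_isPreconnected (y₀ := 0) (y := x)
    (summable_geometric_of_lt_one hr0.le hr1) isOpen_Ioo
    isPreconnected_Ioo hd (fun n y hy => ?_) ⟨by linarith, hr0⟩ (by simp)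
    ⟨by linarith, hxr⟩
  · convert! this using 3 with n
    rw [pow_succ]; field_simp
  · rw [norm_div, norm_pow, Real.norm_eq_abs, Real.norm_of_nonneg (by positivity)]
    have hy' : |y| ≤ r := abs_le.2 ⟨hy.1.le, hy.2.le⟩
    calc |y| ^ n / ((n : ℝ) + 1) ≤ |y| ^ n :=
          div_le_self (by positivity) (by linarith [(Nat.cast_nonneg n : (0 : ℝ) ≤ n)])
      _ ≤ r ^ n := by gcongr

theorem tendsto_log_mul_log_one_sub :
    Tendsto (fun x : ℝ => Real.log x * Real.log (1 - x)) (𝓝[>] 0) (𝓝 0) := by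
  have h1 : HasDerivAt (fun x : ℝ => Real.log (1 - x)) (-1) 0 := by
    have := ((hasDerivAt_id (0 : ℝ)).const_sub 1).log (by simp)
    simpa using this
  have h2 : Tendsto (fun x : ℝ => x⁻¹ * Real.log (1 - x)) (𝓝[>] 0) (𝓝 (-1)) := by
    have := (hasDerivAt_iff_tendsto_slope_zero.1 h1).mono_left
      (nhdsWithin_mono 0 (s := Set.Ioi 0) fun x hx => ne_of_gt hx)
    simpa using this
  have h3 : Tendsto (fun x : ℝ => x * Real.log x) (𝓝[>] 0) (𝓝 0) := by
    have := (Real.continuous_mul_log.tendsto 0).mono_left (nhdsWithin_le_nhds (s := Set.Ioi 0))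
    simpa using this
  have h4 := h3.mul h2
  rw [zero_mul] at h4
  refine h4.congr' (eventually_nhdsWithin_of_forall fun x (hx : 0 < x) => ?_)
  field_simp

/-- A function with zero derivative on `(0, 1)` equals its limit at `0`. -/
theorem eq_of_hasDerivAt_zero_of_tendsto {f : ℝ → ℝ} {c : ℝ}
    (hf : ∀ x ∈ Set.Ioo (0 : ℝ) 1, HasDerivAt f 0 x) (hc : Tendsto f (𝓝[>] 0) (𝓝 c))
    {x : ℝ} (hx : x ∈ Set.Ioo (0 : ℝ) 1) : f x = c := by
  refine tendsto_nhds_unique (tendsto_const_nhds.congr' ?_) hc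
  filter_upwards [Ioo_mem_nhdsGT (zero_lt_one (α := ℝ))] with y hy
  exact (isOpen_Ioo.is_const_of_deriv_eq_zero isPreconnected_Ioo
    (fun z hz => (hf z hz).differentiableAt.differentiableWithinAt)
    (fun z hz => (hf z hz).deriv) hx hy)

theorem tendsto_dilog_zero : Tendsto dilog (𝓝[>] 0) (𝓝 0) := by
  have := (continuousOn_dilog 0 (by simp)).mono_left
    (nhdsWithin_le_of_mem (Icc_mem_nhdsGT (zero_lt_one (α := ℝ))))
  rwa [dilog_zero] at this

theorem tendsto_dilog_one : Tendsto dilog (𝓝[<] 1) (𝓝 (Real.pi ^ 2 / 6)) := by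
  have := (continuousOn_dilog 1 (by simp)).mono_left
    (nhdsWithin_le_of_mem (Icc_mem_nhdsLT (zero_lt_one (α := ℝ))))
  rwa [dilog_one] at this

/-- Euler's reflection formula. -/
theorem dilog_add_dilog_one_sub {x : ℝ} (hx : x ∈ Set.Ioo (0 : ℝ) 1) :
    dilog x + dilog (1 - x) + Real.log x * Real.log (1 - x) = Real.pi ^ 2 / 6 := by
  refine eq_of_hasDerivAt_zero_of_tendsto
    (f := fun x => dilog x + dilog (1 - x) + Real.log x * Real.log (1 - x)) (fun y hy => ?_) ?_ hx
  · have hy' : (0 : ℝ) < 1 - y := sub_pos.2 hy.2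
    have hs := (hasDerivAt_id y).const_sub 1
    have h1 := hasDerivAt_dilog hy.1 hy.2
    have h2 := (hasDerivAt_dilog hy' (by linarith [hy.1])).comp y hs
    have h3 := (Real.hasDerivAt_log hy.1.ne').mul (hs.log hy'.ne')
    convert! (h1.add h2).add h3 using 1
    have := hy.1.ne'
    have := hy'.ne'
    simp only [id, sub_sub_cancel]
    field_simp
    ring
  · have h1 : Tendsto (fun x : ℝ => 1 - x) (𝓝[>] 0) (𝓝[<] 1) := by
      refine tendsto_nhdsWithin_iff.2 ⟨?_, eventually_nhdsWithin_of_forall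
        fun x (hx : 0 < x) => by simpa using hx⟩
      have : Continuous fun x : ℝ => 1 - x := by fun_prop
      simpa using (this.tendsto 0).mono_left (nhdsWithin_le_nhds (s := Set.Ioi 0))
    have := (tendsto_dilog_zero.add (tendsto_dilog_one.comp h1)).add tendsto_log_mul_log_one_sub
    simpa using this

/-- The case `x = y` of Abel's five-term relation. -/
theorem dilog_sq_sub {x : ℝ} (hx : x ∈ Set.Ioo (0 : ℝ) 1) :
    dilog (x ^ 2) - 2 * dilog x + 2 * dilog (x / (1 + x)) + Real.log (1 + x) ^ 2 = 0 := by
  refine eq_of_hasDerivAt_zero_of_tendsto (f := fun x =>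
    dilog (x ^ 2) - 2 * dilog x + 2 * dilog (x / (1 + x)) + Real.log (1 + x) ^ 2)
    (fun y hy => ?_) ?_ hx
  · have hy0 := hy.1
    have hy1 := hy.2
    have hp : 0 < 1 + y := by linarith
    have hm : 0 < 1 - y := by linarith
    have hq : HasDerivAt (fun z : ℝ => z / (1 + z)) (1 / (1 + y) ^ 2) y := by
      convert! (hasDerivAt_id y).div ((hasDerivAt_id y).const_add 1) hp.ne' using 1
      simp
    have h1 := (hasDerivAt_dilog (x := y ^ 2) (by positivity) (by nlinarith)).comp y
      (hasDerivAt_pow 2 y)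
    have h2 := (hasDerivAt_dilog hy0 hy1).const_mul 2
    have h3 := ((hasDerivAt_dilog (x := y / (1 + y)) (by positivity)
      (by rw [div_lt_one hp]; linarith)).comp y hq).const_mul 2
    have h4 := (((hasDerivAt_id y).const_add 1).log hp.ne').pow 2
    convert! ((h1.sub h2).add h3).add h4 using 1
    have e1 : Real.log (1 - y ^ 2) = Real.log (1 - y) + Real.log (1 + y) := by
      rw [← Real.log_mul hm.ne' hp.ne']; ring_nf
    have e2 : Real.log (1 - y / (1 + y)) = -Real.log (1 + y) := by
      rw [← Real.log_inv]; congr 1; field_simp; ring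
    rw [e1, e2]
    simp only [id]
    field_simp
    ring
  · have h2 : Tendsto (fun x : ℝ => x ^ 2) (𝓝[>] 0) (𝓝[>] 0) := by
      refine tendsto_nhdsWithin_iff.2 ⟨?_, eventually_nhdsWithin_of_forall
        fun x (hx : 0 < x) => by simp only [Set.mem_Ioi]; positivity⟩
      have : Continuous fun x : ℝ => x ^ 2 := by fun_prop
      simpa using (this.tendsto 0).mono_left (nhdsWithin_le_nhds (s := Set.Ioi 0))
    have h3 : Tendsto (fun x : ℝ => x / (1 + x)) (𝓝[>] 0) (𝓝[>] 0) := by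
      refine tendsto_nhdsWithin_iff.2 ⟨?_, eventually_nhdsWithin_of_forall
        fun x (hx : 0 < x) => by simp only [Set.mem_Ioi]; positivity⟩
      have : ContinuousAt (fun x : ℝ => x / (1 + x)) 0 := by fun_prop (disch := simp)
      simpa using this.tendsto.mono_left (nhdsWithin_le_nhds (s := Set.Ioi 0))
    have h4 : Tendsto (fun x : ℝ => Real.log (1 + x) ^ 2) (𝓝[>] 0) (𝓝 0) := by
      have : ContinuousAt (fun x : ℝ => Real.log (1 + x) ^ 2) 0 := by fun_prop (disch := simp)
      simpa using this.tendsto.mono_left (nhdsWithin_le_nhds (s := Set.Ioi 0))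
    have := (((tendsto_dilog_zero.comp h2).sub (tendsto_dilog_zero.const_mul 2)).add
      ((tendsto_dilog_zero.comp h3).const_mul 2)).add h4
    simpa using this

-- For $u=\varphi^{-1}$ one has $1-u=u^2=u/(1+u)$, so both functional equations involve only the
-- dilogarithms of $u$ and $u^2$; they form a linear system that determines them.
open Real in
theorem dilog_inv_goldenRatio_sq :
    dilog ((goldenRatio⁻¹) ^ 2) = π ^ 2 / 15 - log goldenRatio ^ 2 := by
  have hg := one_lt_goldenRatio
  have hg0 := goldenRatio_pos
  set u := goldenRatio⁻¹ with hu
  have hu0 : 0 < u := by positivity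
  have hu1 : u < 1 := inv_lt_one_of_one_lt₀ hg
  have hmul : goldenRatio * u = 1 := mul_inv_cancel₀ hg0.ne'
  have hp : 1 + u = goldenRatio := by
    linear_combination (goldenRatio - 1) * hmul - u * goldenRatio_sq
  have hsq : 1 - u = u ^ 2 := by
    linear_combination -hmul - u * hp
  have h1 := dilog_sq_sub ⟨hu0, hu1⟩
  have h2 := dilog_add_dilog_one_sub ⟨hu0, hu1⟩
  rw [hp, div_eq_mul_inv, ← hu, ← sq] at h1
  rw [hsq, log_pow, hu, log_inv, ← hu] at h2
  push_cast at h2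
  linarith

/-! ### Removing the logarithmic singularity -/

/-- The smooth function extending `log ((1 - exp (-x)) / x)`. -/
noncomputable def logExpSlope (x : ℝ) : ℝ :=
  Real.log (dslope (fun x : ℝ => 1 - Real.exp (-x)) 0 x)

theorem dslope_one_sub_exp_neg {x : ℝ} (hx : x ≠ 0) :
    dslope (fun x : ℝ => 1 - Real.exp (-x)) 0 x = (1 - Real.exp (-x)) / x := by
  rw [dslope_of_ne _ hx, slope_def_field]; simp

theorem dslope_one_sub_exp_neg_zero :
    dslope (fun x : ℝ => 1 - Real.exp (-x)) 0 0 = 1 := by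
  have : HasDerivAt (fun x : ℝ => 1 - Real.exp (-x)) 1 0 := by
    simpa using ((hasDerivAt_neg (0 : ℝ)).exp).const_sub 1
  rw [dslope_same, this.deriv]

theorem dslope_one_sub_exp_neg_pos (x : ℝ) :
    0 < dslope (fun x : ℝ => 1 - Real.exp (-x)) 0 x := by
  rcases lt_trichotomy x 0 with h | rfl | h
  · rw [dslope_one_sub_exp_neg h.ne]
    exact div_pos_of_neg_of_neg (by simpa using h) h
  · rw [dslope_one_sub_exp_neg_zero]; exact one_pos
  · rw [dslope_one_sub_exp_neg h.ne']
    exact div_pos (by simpa using h) h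

/-- The singularity at `0` is removable because the divided difference of an analytic function is
analytic. Two derivatives are what the trapezoidal error bound requires. -/
theorem contDiff_logExpSlope : ContDiff ℝ 2 logExpSlope := by
  refine ContDiff.log (contDiff_iff_contDiffAt.2 fun x => ?_)
    fun x => (dslope_one_sub_exp_neg_pos x).ne'
  rcases eq_or_ne x 0 with rfl | hx
  · have ha : AnalyticAt ℝ (fun x : ℝ => 1 - Real.exp (-x)) 0 := by fun_prop
    obtain ⟨p, hp⟩ := ha
    exact AnalyticAt.contDiffAt ⟨_, hp.has_fpower_series_dslope_fslope⟩
  · have : ContDiffAt ℝ 2 (fun x : ℝ => (1 - Real.exp (-x)) / x) x :=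
      ContDiffAt.div (by fun_prop) contDiffAt_id hx
    refine this.congr_of_eventuallyEq ?_
    filter_upwards [isOpen_ne.mem_nhds hx] with y hy
    exact dslope_one_sub_exp_neg hy

theorem logExpSlope_zero : logExpSlope 0 = 0 := by
  rw [logExpSlope, dslope_one_sub_exp_neg_zero, Real.log_one]

theorem log_one_sub_exp_neg {x : ℝ} (hx : 0 < x) :
    Real.log (1 - Real.exp (-x)) = Real.log x + logExpSlope x := by
  have h : 0 < 1 - Real.exp (-x) := by simpa using hx
  rw [logExpSlope, dslope_one_sub_exp_neg hx.ne', Real.log_div h.ne' hx.ne']; ring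

/-- The primitive of `log (1 - exp (-2 t))` vanishing at `0`. -/
noncomputable def logExpPrimitive (t : ℝ) : ℝ :=
  (dilog (Real.exp (-(2 * t))) - Real.pi ^ 2 / 6) / 2

theorem logExpPrimitive_zero : logExpPrimitive 0 = 0 := by
  simp [logExpPrimitive, dilog_one]

theorem continuousOn_logExpPrimitive : ContinuousOn logExpPrimitive (Set.Ici 0) := by
  refine ContinuousOn.div_const (ContinuousOn.sub (continuousOn_dilog.comp (by fun_prop) ?_)
    continuousOn_const) _
  intro t ht
  exact ⟨(Real.exp_pos _).le, Real.exp_le_one_iff.2 (by simpa using ht)⟩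

theorem hasDerivAt_logExpPrimitive {t : ℝ} (ht : 0 < t) :
    HasDerivAt logExpPrimitive (Real.log (1 - Real.exp (-(2 * t)))) t := by
  have h1 : HasDerivAt (fun t : ℝ => Real.exp (-(2 * t))) (Real.exp (-(2 * t)) * (-2)) t := by
    simpa using (((hasDerivAt_id t).const_mul 2).neg).exp
  have h2 := (hasDerivAt_dilog (Real.exp_pos (-(2 * t)))
    (Real.exp_lt_one_iff.2 (by linarith))).comp t h1
  convert! (h2.sub_const (Real.pi ^ 2 / 6)).div_const 2 using 1
  field_simp

/-- The correction is the primitive of $\log(2s)$; it extends continuously to `0`, so the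
fundamental theorem applies up to that endpoint. -/
theorem integral_logExpSlope {t : ℝ} (ht : 0 < t) :
    ∫ s in 0..t, logExpSlope (2 * s) = logExpPrimitive t - (t * Real.log (2 * t) - t) := by
  have hc : Continuous fun s : ℝ => logExpSlope (2 * s) :=
    contDiff_logExpSlope.continuous.comp (by fun_prop)
  have hc2 : Continuous fun s : ℝ => s * Real.log (2 * s) - s := by
    have h : (fun s : ℝ => s * Real.log (2 * s) - s) =
        fun s => (2 * s) * Real.log (2 * s) / 2 - s := by ext; ring
    rw [h]
    exact ((Real.continuous_mul_log.comp (by fun_prop : Continuous fun s : ℝ => 2 * s)).div_const 2).sub continuous_id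
  rw [intervalIntegral.integral_eq_sub_of_hasDerivAt_of_le
    (f := fun s => logExpPrimitive s - (s * Real.log (2 * s) - s)) ht.le
    ((continuousOn_logExpPrimitive.mono Set.Icc_subset_Ici_self).sub hc2.continuousOn)
    (fun s hs => ?_) (hc.intervalIntegrable _ _)]
  · simp [logExpPrimitive_zero]
  · have hs0 : 0 < s := hs.1
    have h1 := (hasDerivAt_id s).mul (((hasDerivAt_id s).const_mul 2).log (by simpa using hs0.ne'))
    have h2 := (hasDerivAt_logExpPrimitive hs0).sub (h1.sub (hasDerivAt_id s))
    convert! h2 using 1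
    rw [log_one_sub_exp_neg (by linarith : 0 < 2 * s)]
    simp only [id]
    field_simp
    ring

/-! ### Euler–Maclaurin summation and asymptotics of a single term -/

/-- Euler–Maclaurin summation with an error of first order in the step. -/
theorem exists_sum_sub_integral_le {f : ℝ → ℝ} (hf : ContDiff ℝ 2 f) (M : ℝ) :
    ∃ C, ∀ (N : ℕ) (ε : ℝ), 0 < N → 0 < ε → N * ε ≤ M →
      |∑ j ∈ Finset.range N, f ((j + 1) * ε) - (∫ s in 0..N * ε, f s) / ε - (f (N * ε) - f 0) / 2|
        ≤ C * ε := by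
  have hcd : Continuous (iteratedDeriv 2 f) := hf.continuous_iteratedDeriv' 2
  obtain ⟨ζ, hζ⟩ := (isCompact_Icc (a := (0 : ℝ)) (b := M)).exists_bound_of_continuousOn
    hcd.continuousOn
  refine ⟨M * ζ / 12, fun N ε hN hε hM => ?_⟩
  have hN' : (0 : ℝ) < N := Nat.cast_pos.2 hN
  have hb : 0 < N * ε := by positivity
  have hζ0 : 0 ≤ ζ := (norm_nonneg _).trans (hζ 0 ⟨le_rfl, hb.le.trans hM⟩)
  have hbound : ∀ x, |iteratedDerivWithin 2 f (Set.uIcc 0 (N * ε)) x| ≤ ζ := by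
    intro x
    rw [Set.uIcc_of_le hb.le]
    by_cases hx : x ∈ Set.Icc 0 (N * ε)
    · rw [iteratedDerivWithin_eq_iteratedDeriv (uniqueDiffOn_Icc hb) hf.contDiffAt hx]
      exact hζ x ⟨hx.1, hx.2.trans hM⟩
    -- The bound is needed at every real `x`; off the closed interval `derivWithin` takes its
    -- default value `0`.
    · rw [iteratedDerivWithin_succ, derivWithin_zero_of_notMem_closure
        (by rwa [isClosed_Icc.closure_eq])]
      simpa using hζ0
  have he := trapezoidal_error_le_of_c2 (a := 0) (b := N * ε) hf.contDiffOn hbound hN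
  have hsum : ∑ j ∈ Finset.range N, f ((j + 1) * ε) =
      ∑ j ∈ Finset.range (N - 1), f ((j + 1) * ε) + f (N * ε) := by
    obtain ⟨m, rfl⟩ := Nat.exists_eq_succ_of_ne_zero hN.ne'
    rw [Finset.sum_range_succ]; simp
  -- The trapezoidal rule gives both endpoints weight 1/2, while the sum omits `0` and counts `N *
  -- ε` fully; hence the correction by half of `f (N * ε) - f 0`.
  have hT : trapezoidal_error f N 0 (N * ε) = ε * (∑ j ∈ Finset.range N, f ((j + 1) * ε) -
      (∫ s in 0..N * ε, f s) / ε - (f (N * ε) - f 0) / 2) := by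
    rw [trapezoidal_error, trapezoidal_integral, hsum]
    have : ∀ k : ℕ, (0 : ℝ) + (k + 1) * (N * ε - 0) / N = (k + 1) * ε := fun k => by
      field_simp; ring
    simp_rw [this]
    field_simp
    ring
  rw [hT, abs_mul, abs_of_pos hε, sub_zero, abs_of_pos hb] at he
  refine le_of_mul_le_mul_left (he.trans ?_) hε
  have : (N * ε) ^ 3 * ζ / (12 * N ^ 2) = (N * ε) * (ζ * ε ^ 2 / 12) := by field_simp
  rw [this]
  calc (N * ε) * (ζ * ε ^ 2 / 12) ≤ M * (ζ * ε ^ 2 / 12) := by gcongr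
    _ = ε * (M * ζ / 12 * ε) := by ring

/-- The logarithm of `oddEvenTerm (exp (-ε)) k`. -/
noncomputable def logOddEvenTerm (ε : ℝ) (k : ℕ) : ℝ :=
  ∑ j ∈ Finset.range k, (-((j + 1) * ε) - Real.log (1 - Real.exp (-(2 * ((j + 1) * ε)))))

theorem oddEvenTerm_exp {ε : ℝ} (hε : 0 < ε) (k : ℕ) :
    oddEvenTerm (Real.exp (-ε)) k = Real.exp (logOddEvenTerm ε k) := by
  rw [oddEvenTerm, logOddEvenTerm, Real.exp_sum]
  refine Finset.prod_congr rfl fun j _ => ?_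
  have h : (0 : ℝ) < 2 * ((j + 1) * ε) := by positivity
  rw [Real.exp_sub, Real.exp_log (by simpa using h), ← Real.exp_nat_mul, ← Real.exp_nat_mul]
  push_cast
  ring_nf

/-- The leading exponent of `oddEvenTerm (exp (-ε)) k`, as a function of `t = k ε`. -/
noncomputable def oddEvenPhase (t : ℝ) : ℝ := -t ^ 2 / 2 - logExpPrimitive t

/-- Splitting off $\log(2j\varepsilon)$ from each summand produces $\log k!$, which
`Stirling.stirlingSeq` normalises. The last bracket is exactly the Euler–Maclaurin error of the
smooth remainder. -/
theorem logOddEvenTerm_eq {ε : ℝ} (hε : 0 < ε) {k : ℕ} (hk : 0 < k) :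
    logOddEvenTerm ε k - oddEvenPhase (k * ε) / ε - Real.log ε / 2 =
      -(k * ε) / 2 - Real.log (Stirling.stirlingSeq k) -
        Real.log (1 - Real.exp (-(2 * (k * ε)))) / 2 -
        (∑ j ∈ Finset.range k, logExpSlope (2 * ((j + 1) * ε)) -
          (∫ s in 0..k * ε, logExpSlope (2 * s)) / ε -
          (logExpSlope (2 * (k * ε)) - logExpSlope (2 * 0)) / 2) := by
  have hk' : (0 : ℝ) < k := Nat.cast_pos.2 hk
  have hsplit : logOddEvenTerm ε k = -(ε * (k * (k + 1) / 2)) - (k * Real.log (2 * ε) +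
      Real.log (k.factorial)) - ∑ j ∈ Finset.range k, logExpSlope (2 * ((j + 1) * ε)) := by
    clear hk hk'
    rw [logOddEvenTerm]
    induction k with
    | zero => simp
    | succ k ih =>
      rw [Finset.sum_range_succ, ih, Finset.sum_range_succ, Nat.factorial_succ,
        log_one_sub_exp_neg (by positivity)]
      have e1 : Real.log (2 * ((k + 1) * ε)) = Real.log (k + 1) + Real.log (2 * ε) := by
        rw [← Real.log_mul (by positivity) (by positivity)]; ring_nf
      rw [e1]
      push_cast
      rw [Real.log_mul (x := (k : ℝ) + 1) (y := k.factorial) (by positivity) (by positivity)]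
      ring
  have e1 : Real.log (2 * (k * ε)) = Real.log k + Real.log (2 * ε) := by
    rw [← Real.log_mul (by positivity) (by positivity)]; ring_nf
  have e2 : Real.log (2 * k) = Real.log 2 + Real.log k :=
    Real.log_mul (by positivity) (by positivity)
  have e3 : Real.log (2 * ε) = Real.log 2 + Real.log ε :=
    Real.log_mul (by positivity) (by positivity)
  rw [hsplit, integral_logExpSlope (by positivity), Stirling.log_stirlingSeq_formula,
    log_one_sub_exp_neg (x := 2 * (k * ε)) (by positivity), mul_zero, logExpSlope_zero,
    Real.log_div hk'.ne' (Real.exp_pos 1).ne', Real.log_exp, e1, e2, e3, oddEvenPhase]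
  field_simp
  ring

/-- If `k ε → T > 0`, the `k`-th term is `√ε exp (oddEvenPhase (k ε) / ε)` up to a constant. -/
theorem tendsto_logOddEvenTerm_sub {k : ℝ → ℕ} {T : ℝ} (hT : 0 < T)
    (hk : Tendsto (fun ε => k ε * ε) (𝓝[>] 0) (𝓝 T)) :
    Tendsto (fun ε => logOddEvenTerm ε (k ε) - oddEvenPhase (k ε * ε) / ε - Real.log ε / 2)
      (𝓝[>] 0) (𝓝 (-T / 2 - Real.log (√Real.pi) - Real.log (1 - Real.exp (-(2 * T))) / 2)) := by
  obtain ⟨C, hC⟩ := exists_sum_sub_integral_le (f := fun s => logExpSlope (2 * s))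
    (contDiff_logExpSlope.comp (by fun_prop)) (T + 1)
  have hid : Tendsto (fun ε : ℝ => ε) (𝓝[>] 0) (𝓝 0) := nhdsWithin_le_nhds
  have hktop : Tendsto k (𝓝[>] 0) atTop := by
    rw [← tendsto_natCast_atTop_iff (R := ℝ)]
    have := hk.pos_mul_atTop hT tendsto_inv_nhdsGT_zero
    refine this.congr' (eventually_nhdsWithin_of_forall fun ε (hε : 0 < ε) => ?_)
    field_simp
  have hpos : ∀ᶠ ε in 𝓝[>] (0 : ℝ), 0 < ε := eventually_mem_nhdsWithin
  have hkpos := hktop.eventually_gt_atTop 0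
  have herr : Tendsto (fun ε => ∑ j ∈ Finset.range (k ε), logExpSlope (2 * ((j + 1) * ε)) -
          (∫ s in 0..k ε * ε, logExpSlope (2 * s)) / ε -
          (logExpSlope (2 * (k ε * ε)) - logExpSlope (2 * 0)) / 2) (𝓝[>] 0) (𝓝 0) := by
    refine squeeze_zero_norm' ?_ (by simpa using hid.const_mul C)
    filter_upwards [hpos, hkpos, hk.eventually_lt_const (lt_add_one T)] with ε h1 h2 h3
    exact hC (k ε) ε h2 h1 h3.le
  have hst := ((Stirling.tendsto_stirlingSeq_sqrt_pi.comp hktop).log (by positivity))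
  have hlog : Tendsto (fun ε => Real.log (1 - Real.exp (-(2 * (k ε * ε))))) (𝓝[>] 0)
      (𝓝 (Real.log (1 - Real.exp (-(2 * T))))) := by
    refine Tendsto.log ?_ (by have : Real.exp (-(2 * T)) < 1 := Real.exp_lt_one_iff.2 (by linarith)
                              linarith)
    exact ((hk.const_mul 2).neg.rexp).const_sub 1
  have := (((hk.neg.div_const 2).sub hst).sub (hlog.div_const 2)).sub herr
  rw [sub_zero] at this
  refine this.congr' ?_
  filter_upwards [hpos, hkpos] with ε h1 h2
  exact (logOddEvenTerm_eq h1 h2).symm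

/-! ### The critical point, the logarithm of the golden ratio -/

open Real in
theorem exp_neg_log_goldenRatio : exp (-log goldenRatio) = goldenRatio⁻¹ := by
  rw [exp_neg, exp_log goldenRatio_pos]

open Real in
theorem exp_neg_two_mul_log_goldenRatio :
    exp (-(2 * log goldenRatio)) = goldenRatio⁻¹ ^ 2 := by
  rw [← exp_neg_log_goldenRatio, ← exp_nat_mul]; push_cast; ring_nf

open Real in
theorem inv_goldenRatio_eq_sub_one : goldenRatio⁻¹ = goldenRatio - 1 := by
  rw [inv_goldenRatio, ← one_sub_goldenConj]; ring

open Real in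
theorem one_sub_inv_goldenRatio_sq : 1 - goldenRatio⁻¹ ^ 2 = goldenRatio⁻¹ := by
  rw [inv_goldenRatio_eq_sub_one]
  linear_combination -goldenRatio_sq

open Real in
theorem log_one_sub_exp_goldenRatio :
    log (1 - exp (-(2 * log goldenRatio))) = -log goldenRatio := by
  rw [exp_neg_two_mul_log_goldenRatio, one_sub_inv_goldenRatio_sq, log_inv]

theorem log_goldenRatio_pos : 0 < Real.log Real.goldenRatio := Real.log_pos Real.one_lt_goldenRatio

theorem oddEvenPhase_log_goldenRatio :
    oddEvenPhase (Real.log Real.goldenRatio) = Real.pi ^ 2 / 20 := by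
  rw [oddEvenPhase, logExpPrimitive, exp_neg_two_mul_log_goldenRatio, dilog_inv_goldenRatio_sq]
  ring

/-- The derivative of `oddEvenPhase`. -/
noncomputable def oddEvenSlope (t : ℝ) : ℝ := -t - Real.log (1 - Real.exp (-(2 * t)))

theorem hasDerivAt_oddEvenPhase {t : ℝ} (ht : 0 < t) :
    HasDerivAt oddEvenPhase (oddEvenSlope t) t := by
  convert! (((hasDerivAt_pow 2 t).neg.div_const 2).sub (hasDerivAt_logExpPrimitive ht)) using 1
  simp only [oddEvenSlope]; ring

theorem oddEvenSlope_log_goldenRatio : oddEvenSlope (Real.log Real.goldenRatio) = 0 := by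
  rw [oddEvenSlope, log_one_sub_exp_goldenRatio]; ring

-- The derivative is $-1-2e^{-2t}/(1-e^{-2t})$; with $u=\varphi^{-1}$, $e^{-2t}=u^2$ and $1-u^2=u$
-- it becomes $-1-2u=-\sqrt5$.
open Real in
theorem hasDerivAt_oddEvenSlope : HasDerivAt oddEvenSlope (-√5) (log goldenRatio) := by
  have h1 : HasDerivAt (fun t : ℝ => exp (-(2 * t)))
      (exp (-(2 * log goldenRatio)) * (-2)) (log goldenRatio) := by
    simpa using (((hasDerivAt_id (log goldenRatio)).const_mul 2).neg).exp
  rw [exp_neg_two_mul_log_goldenRatio] at h1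
  have hne : (0 : ℝ) < 1 - exp (-(2 * log goldenRatio)) := by
    rw [exp_neg_two_mul_log_goldenRatio, one_sub_inv_goldenRatio_sq]
    exact inv_pos.2 goldenRatio_pos
  have h2 := (hasDerivAt_neg (log goldenRatio)).sub ((h1.const_sub 1).log hne.ne')
  convert! h2 using 1
  rw [exp_neg_two_mul_log_goldenRatio, one_sub_inv_goldenRatio_sq]
  have h5 : √5 = 2 * goldenRatio - 1 := by rw [goldenRatio]; ring
  have hu := inv_goldenRatio_eq_sub_one
  have hu0 := inv_ne_zero goldenRatio_ne_zero
  generalize goldenRatio⁻¹ = u at hu hu0 ⊢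
  rw [h5, show -(u ^ 2 * -2) / u = 2 * u by field_simp, hu]
  ring

/-- The slope decreases at least as fast as `-t`. -/
theorem oddEvenSlope_le {t : ℝ} (ht : Real.log Real.goldenRatio ≤ t) :
    oddEvenSlope t ≤ Real.log Real.goldenRatio - t := by
  have hpos := log_goldenRatio_pos
  have h : Real.log (1 - Real.exp (-(2 * Real.log Real.goldenRatio))) ≤
      Real.log (1 - Real.exp (-(2 * t))) := by
    refine Real.log_le_log (sub_pos.2 (Real.exp_lt_one_iff.2 (by linarith))) ?_
    gcongr
  rw [log_one_sub_exp_goldenRatio] at h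
  rw [oddEvenSlope]; linarith

theorem le_oddEvenSlope {t : ℝ} (h0 : 0 < t) (ht : t ≤ Real.log Real.goldenRatio) :
    Real.log Real.goldenRatio - t ≤ oddEvenSlope t := by
  have h : Real.log (1 - Real.exp (-(2 * t))) ≤
      Real.log (1 - Real.exp (-(2 * Real.log Real.goldenRatio))) := by
    refine Real.log_le_log (sub_pos.2 (Real.exp_lt_one_iff.2 (by linarith))) ?_
    gcongr
  rw [log_one_sub_exp_goldenRatio] at h
  rw [oddEvenSlope]; linarith

/-! ### Gaussian decay and local expansion of the terms -/

theorem logOddEvenTerm_succ (ε : ℝ) (k : ℕ) :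
    logOddEvenTerm ε (k + 1) = logOddEvenTerm ε k + oddEvenSlope ((k + 1) * ε) := by
  rw [logOddEvenTerm, Finset.sum_range_succ, ← logOddEvenTerm, oddEvenSlope]

/-- Gaussian decay of the terms away from the largest one. -/
theorem logOddEvenTerm_le {ε : ℝ} (hε : 0 < ε) {m : ℕ} (h1 : m * ε ≤ Real.log Real.goldenRatio)
    (h2 : Real.log Real.goldenRatio ≤ (m + 1) * ε) (k : ℕ) :
    logOddEvenTerm ε k ≤
      logOddEvenTerm ε m - ε * (|(k : ℝ) - m| * (|(k : ℝ) - m| - 1) / 2) := by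
  rcases le_total m k with h | h
  · rw [abs_of_nonneg (sub_nonneg.2 (Nat.cast_le.2 h))]
    induction k, h using Nat.le_induction with
    | base => simp
    | succ k hk ih =>
      have hmk : (m : ℝ) ≤ k := Nat.cast_le.2 hk
      -- The critical point is at most `(m + 1) * ε`, so the step from `k` to `k + 1` loses at least
      -- `ε * (k - m)`; these losses add up to the triangular number in the claim.
      have hs : oddEvenSlope ((k + 1) * ε) ≤ -(ε * (k - m)) := by
        have : (m + 1) * ε ≤ (k + 1) * ε := by gcongr
        have := oddEvenSlope_le (h2.trans this)
        nlinarith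
      rw [logOddEvenTerm_succ]
      push_cast
      linarith
  · rw [abs_of_nonpos (sub_nonpos.2 (Nat.cast_le.2 h))]
    induction h using Nat.decreasingInduction with
    | self => simp
    | of_succ k hk ih =>
      have hmk : (k : ℝ) + 1 ≤ m := by exact_mod_cast hk
      have hs : ε * (m - k - 1) ≤ oddEvenSlope ((k + 1) * ε) := by
        have : (k + 1) * ε ≤ m * ε := by gcongr
        have := le_oddEvenSlope (by positivity) (this.trans h1)
        nlinarith
      rw [logOddEvenTerm_succ] at ih
      push_cast at ih
      linarith

/-- Second order expansion of a function at a critical point. -/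
theorem exists_tendsto_second_order {F g : ℝ → ℝ} {T c : ℝ}
    (hF : ∀ᶠ t in 𝓝 T, HasDerivAt F (g t) t) (hg : HasDerivAt g c T) (h0 : g T = 0) :
    ∃ R : ℝ → ℝ, Tendsto R (𝓝 T) (𝓝 (c / 2)) ∧ ∀ t, F t - F T = R t * (t - T) ^ 2 := by
  classical
  -- At `T` the quotient would be `0 / 0 = 0`; the value `c / 2` makes `R` continuous there.
  refine ⟨Function.update (fun t => (F t - F T) / (t - T) ^ 2) T (c / 2), ?_, fun t => ?_⟩
  · have hlim : Tendsto (fun t => (F t - F T) / (t - T) ^ 2) (𝓝[≠] T) (𝓝 (c / 2)) := by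
      refine HasDerivAt.lhopital_zero_nhdsNE (f' := g) (g' := fun t => 2 * (t - T)) ?_ ?_ ?_ ?_ ?_ ?_
      · exact (hF.filter_mono nhdsWithin_le_nhds).mono fun t ht => ht.sub_const _
      · refine Eventually.of_forall fun t => ?_
        convert! ((hasDerivAt_id t).sub_const T).pow 2 using 1
        simp
      · exact eventually_nhdsWithin_of_forall fun t ht =>
          mul_ne_zero two_ne_zero (sub_ne_zero.2 ht)
      · have : ContinuousAt (fun t => F t - F T) T :=
          hF.self_of_nhds.continuousAt.sub continuousAt_const
        simpa using this.tendsto.mono_left nhdsWithin_le_nhds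
      · have : ContinuousAt (fun t : ℝ => (t - T) ^ 2) T := by fun_prop
        simpa using this.tendsto.mono_left nhdsWithin_le_nhds
      · refine ((hasDerivAt_iff_tendsto_slope.1 hg).div_const 2).congr fun t => ?_
        rw [slope_def_field, h0, sub_zero, div_div, mul_comm]
    have := continuousAt_update_same.2 hlim
    simpa [ContinuousAt] using this
  · rcases eq_or_ne t T with rfl | ht
    · simp
    · rw [Function.update_of_ne ht]
      have := sub_ne_zero.2 ht
      field_simp

/-- Local central limit asymptotics of the terms. -/
theorem tendsto_logOddEvenTerm_floor {k : ℝ → ℕ} {y : ℝ}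
    (hk : Tendsto (fun ε => (k ε * ε - Real.log Real.goldenRatio) / √ε) (𝓝[>] 0) (𝓝 y)) :
    Tendsto (fun ε => logOddEvenTerm ε (k ε) - Real.pi ^ 2 / 20 / ε - Real.log ε / 2)
      (𝓝[>] 0) (𝓝 (-√5 / 2 * y ^ 2 - Real.log (√Real.pi))) := by
  have hpos : ∀ᶠ ε in 𝓝[>] (0 : ℝ), 0 < ε := eventually_mem_nhdsWithin
  have hsq : Tendsto (fun ε : ℝ => √ε) (𝓝[>] 0) (𝓝 0) := by
    simpa using (Real.continuous_sqrt.tendsto 0).mono_left (nhdsWithin_le_nhds (s := Set.Ioi 0))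
  have hkT : Tendsto (fun ε => k ε * ε) (𝓝[>] 0) (𝓝 (Real.log Real.goldenRatio)) := by
    have := (hk.mul hsq).add_const (Real.log Real.goldenRatio)
    rw [mul_zero, zero_add] at this
    refine this.congr' ?_
    filter_upwards [hpos] with ε hε
    have := (Real.sqrt_pos.2 hε).ne'
    field_simp
    ring
  obtain ⟨R, hR, hRF⟩ := exists_tendsto_second_order
    ((eventually_gt_nhds log_goldenRatio_pos).mono fun t ht => hasDerivAt_oddEvenPhase ht)
    hasDerivAt_oddEvenSlope oddEvenSlope_log_goldenRatio
  have h1 := tendsto_logOddEvenTerm_sub log_goldenRatio_pos hkT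
  have h2 := h1.add ((hR.comp hkT).mul (hk.pow 2))
  -- At the critical point $T$, $\log(1-e^{-2T})=-T$, so this term cancels $-T/2$ and only
  -- $-\log\sqrt\pi$ survives.
  rw [log_one_sub_exp_goldenRatio] at h2
  convert! h2.congr' ?_ using 2
  · ring
  · filter_upwards [hpos] with ε hε
    have h3 := hRF (k ε * ε)
    rw [oddEvenPhase_log_goldenRatio] at h3
    rw [div_pow, Real.sq_sqrt hε.le, Function.comp_apply, ← mul_div_assoc, ← h3]
    ring

/-! ### Sums as integrals of step functions -/

-- The indicator is essential: `⌊x⌋₊` is `0` for negative `x`, which would otherwise contribute `a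
-- 0` on a half-line.
open MeasureTheory in
theorem integral_indicator_floor {a : ℕ → ℝ} (ha : ∀ k, 0 ≤ a k) (hs : Summable a) :
    ∫ x : ℝ, (Set.Ici 0).indicator (fun x => a ⌊x⌋₊) x = ∑' k, a k := by
  have hU : ⋃ n : ℕ, Set.Ico (n : ℝ) (n + 1) = Set.Ici 0 := by
    ext x
    simp only [Set.mem_iUnion, Set.mem_Ico, Set.mem_Ici]
    exact ⟨fun ⟨n, hn, _⟩ => (Nat.cast_nonneg n).trans hn,
      fun hx => ⟨⌊x⌋₊, Nat.floor_le hx, Nat.lt_floor_add_one x⟩⟩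
  have hd : Pairwise (Function.onFun Disjoint fun n : ℕ => Set.Ico (n : ℝ) (n + 1)) := by
    intro m n hmn
    have := Set.pairwise_disjoint_Ico_intCast ℝ (Int.ofNat_inj.ne.2 hmn)
    simpa [Function.onFun] using this
  have hc : ∀ n : ℕ, Set.EqOn (fun x : ℝ => a ⌊x⌋₊) (fun _ => a n) (Set.Ico (n : ℝ) (n + 1)) :=
    fun n x hx => congrArg a (Nat.floor_eq_on_Ico n x hx)
  have hint : ∀ n : ℕ, ∫ x in Set.Ico (n : ℝ) (n + 1), a ⌊x⌋₊ = a n := fun n => by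
    rw [setIntegral_congr_fun measurableSet_Ico (hc n)]; simp
  rw [integral_indicator measurableSet_Ici, ← hU, integral_iUnion (fun n => measurableSet_Ico) hd]
  · exact tsum_congr hint
  · refine integrableOn_iUnion_of_summable_integral_norm (fun n => ?_) ?_
    · exact (integrableOn_congr_fun (hc n) measurableSet_Ico).2 (integrableOn_const (by simp))
    · simpa only [Real.norm_of_nonneg (ha _), hint] using hs

/-- Summation over the naturals as an integral, rescaled by `d` around `c`. -/
theorem integral_indicator_floor_comp {a : ℕ → ℝ} (ha : ∀ k, 0 ≤ a k) (hs : Summable a)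
    (c : ℝ) {d : ℝ} (hd : 0 < d) :
    ∫ y : ℝ, (Set.Ici 0).indicator (fun x => a ⌊x⌋₊) (c + y / d) = d * ∑' k, a k := by
  simp_rw [div_eq_mul_inv]
  rw [MeasureTheory.Measure.integral_comp_mul_right
      (fun z => (Set.Ici 0).indicator (fun x => a ⌊x⌋₊) (c + z)) d⁻¹,
    MeasureTheory.integral_add_left_eq_self (fun x => (Set.Ici 0).indicator (fun x => a ⌊x⌋₊) x) c,
    integral_indicator_floor ha hs, inv_inv, abs_of_pos hd, smul_eq_mul]

theorem summable_oddEvenTerm {q : ℝ} (h0 : 0 < q) (h1 : q < 1) : Summable (oddEvenTerm q) := by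
  have hq : ∀ j : ℕ, 0 < 1 - q ^ (2 * (j + 1)) := fun j =>
    sub_pos.2 (pow_lt_one₀ h0.le h1 (by omega))
  have hpos : ∀ k, 0 < oddEvenTerm q k := fun k =>
    Finset.prod_pos fun j _ => div_pos (by positivity) (hq j)
  refine summable_of_ratio_test_tendsto_lt_one zero_lt_one
    (Eventually.of_forall fun k => (hpos k).ne') ?_
  have hp : Tendsto (fun k : ℕ => q ^ (k + 1)) atTop (𝓝 0) :=
    (tendsto_pow_atTop_nhds_zero_of_lt_one h0.le h1).comp (tendsto_add_atTop_nat 1)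
  have hlim := hp.div ((hp.pow 2).const_sub 1) (by norm_num)
  rw [zero_div] at hlim
  refine hlim.congr fun k => ?_
  rw [Real.norm_of_nonneg (hpos _).le, Real.norm_of_nonneg (hpos _).le]
  conv_rhs => rw [oddEvenTerm, Finset.prod_range_succ, ← oddEvenTerm,
    mul_div_cancel_left₀ _ (hpos k).ne']
  simp only [Pi.div_apply]
  rw [← pow_mul, mul_comm]

/-! ### Rescaling and dominated convergence -/

/-- The terms, normalised and seen at the scale `√ε` around the largest one. -/
noncomputable def rescaledTerm (ε y : ℝ) : ℝ :=
  Real.exp (-(Real.pi ^ 2 / 20 / ε)) / √ε * (Set.Ici 0).indicator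
    (fun x => Real.exp (logOddEvenTerm ε ⌊x⌋₊)) (Real.log Real.goldenRatio / ε + y / √ε)

theorem integral_rescaledTerm {ε : ℝ} (hε : 0 < ε) :
    ∫ y, rescaledTerm ε y =
      Real.exp (-(Real.pi ^ 2 / 20 / ε)) * ∑' k, oddEvenTerm (Real.exp (-ε)) k := by
  have hs := summable_oddEvenTerm (Real.exp_pos (-ε)) (Real.exp_lt_one_iff.2 (by linarith))
  have hd := Real.sqrt_pos.2 hε
  simp only [rescaledTerm]
  rw [MeasureTheory.integral_const_mul]
  simp only [← oddEvenTerm_exp hε]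
  rw [integral_indicator_floor_comp (fun k => ?_) hs _ hd]
  · field_simp
  · rw [oddEvenTerm_exp hε]; positivity

/-- Rounding down moves `k ε` by at most `ε`, which is only `√ε` after division by `√ε`. -/
theorem tendsto_floor_rescaled (y : ℝ) :
    (∀ᶠ ε in 𝓝[>] (0 : ℝ), 0 ≤ Real.log Real.goldenRatio / ε + y / √ε) ∧
    Tendsto (fun ε => (⌊Real.log Real.goldenRatio / ε + y / √ε⌋₊ * ε -
      Real.log Real.goldenRatio) / √ε) (𝓝[>] 0) (𝓝 y) := by
  have hpos : ∀ᶠ ε in 𝓝[>] (0 : ℝ), 0 < ε := eventually_mem_nhdsWithin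
  have hsq : Tendsto (fun ε : ℝ => √ε) (𝓝[>] 0) (𝓝 0) := by
    simpa using (Real.continuous_sqrt.tendsto 0).mono_left (nhdsWithin_le_nhds (s := Set.Ioi 0))
  have hmul : ∀ ε : ℝ, 0 < ε →
      (Real.log Real.goldenRatio / ε + y / √ε) * ε = Real.log Real.goldenRatio + y * √ε := by
    intro ε hε
    have h := (Real.sqrt_pos.2 hε).ne'
    rw [add_mul, div_mul_cancel₀ _ hε.ne', div_mul_eq_mul_div]
    congr 1
    rw [div_eq_iff h, mul_assoc, Real.mul_self_sqrt hε.le]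
  have hnn : ∀ᶠ ε in 𝓝[>] (0 : ℝ), 0 ≤ Real.log Real.goldenRatio / ε + y / √ε := by
    have h := (hsq.const_mul y).const_add (Real.log Real.goldenRatio)
    rw [mul_zero, add_zero] at h
    filter_upwards [h.eventually_const_lt log_goldenRatio_pos, hpos] with ε h1 hε
    rw [← hmul ε hε] at h1
    exact (pos_of_mul_pos_left h1 hε.le).le
  refine ⟨hnn, tendsto_of_tendsto_of_tendsto_of_le_of_le'
    (by simpa using hsq.const_sub y) tendsto_const_nhds ?_ ?_⟩
  all_goals
    filter_upwards [hnn, hpos] with ε h0 hε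
    have h1 := mul_le_mul_of_nonneg_right (Nat.floor_le h0) hε.le
    have h2 := mul_le_mul_of_nonneg_right
      (Nat.lt_floor_add_one (Real.log Real.goldenRatio / ε + y / √ε)).le hε.le
    rw [hmul ε hε] at h1 h2
    have hd := Real.sqrt_pos.2 hε
    have hss := Real.mul_self_sqrt hε.le
  · rw [le_div_iff₀ hd]; nlinarith
  · rw [div_le_iff₀ hd]; linarith

theorem tendsto_rescaledTerm (y : ℝ) :
    Tendsto (fun ε => rescaledTerm ε y) (𝓝[>] 0)
      (𝓝 (Real.exp (-(√5 / 2) * y ^ 2) * (√Real.pi)⁻¹)) := by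
  obtain ⟨hnn, hlim⟩ := tendsto_floor_rescaled y
  have h := (tendsto_logOddEvenTerm_floor hlim).rexp
  rw [Real.exp_sub, Real.exp_log (by positivity)] at h
  convert! h.congr' ?_ using 2
  · rw [div_eq_mul_inv]; ring_nf
  · filter_upwards [hnn, eventually_mem_nhdsWithin] with ε h0 (hε : 0 < ε)
    rw [rescaledTerm, Set.indicator_of_mem (Set.mem_Ici.2 h0), Real.exp_sub, Real.exp_sub, ← Real.log_sqrt hε.le,
      Real.exp_log (Real.sqrt_pos.2 hε), Real.exp_neg]
    field_simp

/-- Comparing with the term at `y = 0`, whose index `m` is next to the critical point, leaves only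
the decay of `logOddEvenTerm_le` to estimate. -/
theorem norm_rescaledTerm_le {ε : ℝ} (h0 : 0 < ε) (h1 : ε ≤ 1) (y : ℝ) :
    ‖rescaledTerm ε y‖ ≤ rescaledTerm ε 0 * (Real.exp 1 * Real.exp (-(1 / 8) * y ^ 2)) := by
  have hT := log_goldenRatio_pos
  have hd := Real.sqrt_pos.2 h0
  have hx0 : (0 : ℝ) ≤ Real.log Real.goldenRatio / ε := by positivity
  have e0 : rescaledTerm ε 0 = Real.exp (-(Real.pi ^ 2 / 20 / ε)) / √ε *
      Real.exp (logOddEvenTerm ε ⌊Real.log Real.goldenRatio / ε⌋₊) := by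
    rw [rescaledTerm, zero_div, add_zero, Set.indicator_of_mem (by exact hx0)]
  rw [e0, rescaledTerm, norm_mul, Real.norm_of_nonneg (by positivity), mul_assoc]
  refine mul_le_mul_of_nonneg_left ?_ (by positivity)
  set x := Real.log Real.goldenRatio / ε + y / √ε with hx
  by_cases hxn : x ∈ Set.Ici (0 : ℝ)
  swap
  · rw [Set.indicator_of_notMem hxn, norm_zero]; positivity
  rw [Set.indicator_of_mem hxn, Real.norm_of_nonneg (Real.exp_pos _).le, ← Real.exp_add,
    ← Real.exp_add, Real.exp_le_exp]
  set m := ⌊Real.log Real.goldenRatio / ε⌋₊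
  have hm1 := Nat.floor_le hx0
  have hm2 := Nat.lt_floor_add_one (Real.log Real.goldenRatio / ε)
  have hk1 := Nat.floor_le (Set.mem_Ici.1 hxn)
  have hk2 := Nat.lt_floor_add_one x
  have hle := logOddEvenTerm_le h0 (m := m) ((le_div_iff₀ h0).1 hm1) ((div_le_iff₀ h0).1 hm2.le) ⌊x⌋₊
  have hz : |y / √ε| ≤ |(⌊x⌋₊ : ℝ) - m| + 1 := by
    have : |y / √ε - ((⌊x⌋₊ : ℝ) - m)| ≤ 1 := abs_le.2 ⟨by linarith, by linarith⟩
    have := abs_sub_abs_le_abs_sub (y / √ε) ((⌊x⌋₊ : ℝ) - m)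
    linarith
  have hy : y ^ 2 = ε * |y / √ε| ^ 2 := by
    rw [sq_abs, div_pow, Real.sq_sqrt h0.le]; field_simp
  have hsq : |y / √ε| ^ 2 ≤ (|(⌊x⌋₊ : ℝ) - m| + 1) ^ 2 := by gcongr
  refine hle.trans ?_
  generalize |(⌊x⌋₊ : ℝ) - m| = s at hsq ⊢
  -- The difference of the right side and $(s+1)^2/8-1/2$ is $3(s-1)^2/8$. The loss `1 / 2`,
  -- multiplied by `ε ≤ 1`, is covered by the factor `Real.exp 1`.
  have h3 : |y / √ε| ^ 2 / 8 - 1 / 2 ≤ s * (s - 1) / 2 := by nlinarith [sq_nonneg (s - 1)]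
  have h4 := mul_le_mul_of_nonneg_left h3 h0.le
  rw [hy]
  linarith

theorem measurable_rescaledTerm (ε : ℝ) : Measurable (rescaledTerm ε) := by
  refine Measurable.const_mul (Measurable.comp (Measurable.indicator ?_ measurableSet_Ici)
    (by fun_prop)) _
  exact (measurable_from_top (f := fun k : ℕ => Real.exp (logOddEvenTerm ε k))).comp
    Nat.measurable_floor

theorem tendsto_integral_rescaledTerm :
    Tendsto (fun ε => ∫ y, rescaledTerm ε y) (𝓝[>] 0) (𝓝 (√(2 / √5))) := by
  have hI : ∫ y : ℝ, Real.exp (-(√5 / 2) * y ^ 2) * (√Real.pi)⁻¹ = √(2 / √5) := by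
    rw [MeasureTheory.integral_mul_const, integral_gaussian, ← Real.sqrt_inv,
      ← Real.sqrt_mul (by positivity)]
    congr 1
    have := Real.pi_ne_zero
    field_simp
  rw [← hI]
  have h0 := tendsto_rescaledTerm 0
  set c := Real.exp (-(√5 / 2) * 0 ^ 2) * (√Real.pi)⁻¹
  refine MeasureTheory.tendsto_integral_filter_of_dominated_convergence
    (fun y => (c + 1) * (Real.exp 1 * Real.exp (-(1 / 8) * y ^ 2)))
    (Eventually.of_forall fun ε => (measurable_rescaledTerm ε).aestronglyMeasurable) ?_
    (((integrable_exp_neg_mul_sq (by norm_num)).const_mul _).const_mul _)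
    (Eventually.of_forall tendsto_rescaledTerm)
  -- Convergence at `y = 0` bounds the prefactor `rescaledTerm ε 0` by `c + 1` for small `ε`, so the
  -- dominating function does not depend on `ε`.
  filter_upwards [h0.eventually_lt_const (lt_add_one c), Ioc_mem_nhdsGT (zero_lt_one (α := ℝ))]
    with ε h1 hε
  refine Eventually.of_forall fun y => (norm_rescaledTerm_le hε.1 hε.2 y).trans ?_
  gcongr

theorem mainTheorem4 :
    (∀ ε : ℝ, 0 < ε →
      Summable fun n : ℕ => (OE (n + 1) : ℝ) * Real.exp (-ε) ^ (n + 1)) ∧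
    (fun ε : ℝ => oddEvenGenFun (Real.exp (-ε))) ~[𝓝[>] (0 : ℝ)]
      fun ε : ℝ => √(2 / √5) * Real.exp (Real.pi ^ 2 / (20 * ε)) := by
  have hsum : ∀ ε : ℝ, 0 < ε → HasSum (fun n => (OE n : ℝ) * Real.exp (-ε) ^ n)
      (∑' k, oddEvenTerm (Real.exp (-ε)) k) := fun ε hε =>
    have h1 : Real.exp (-ε) < 1 := Real.exp_lt_one_iff.2 (by linarith)
    hasSum_OE (Real.exp_pos _) h1 (summable_oddEvenTerm (Real.exp_pos _) h1)
  refine ⟨fun ε hε => (summable_nat_add_iff 1).2 (hsum ε hε).summable, ?_⟩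
  have hne : √(2 / √5) ≠ 0 := by positivity
  refine isEquivalent_of_tendsto_one ?_
  have h := tendsto_integral_rescaledTerm.div_const (√(2 / √5))
  rw [div_self hne] at h
  refine h.congr' (eventually_nhdsWithin_of_forall fun ε (hε : 0 < ε) => ?_)
  have hgen : oddEvenGenFun (Real.exp (-ε)) = ∑' k, oddEvenTerm (Real.exp (-ε)) k := by
    rw [← (hsum ε hε).tsum_eq, (hsum ε hε).summable.tsum_eq_zero_add, oddEvenGenFun, OE_zero]
    simp
  rw [Pi.div_apply, hgen, integral_rescaledTerm hε, Real.exp_neg, div_div]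
  field_simp
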